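/- All Banach algebras are over $\mathbb C$. For a Banach algebra $\mathfrak A$ let $\mathfrak A\otimes^\gamma\mathfrak A$ be the projective tensor product, $m:\mathfrak A\otimes^\gamma\mathfrak A\to\mathfrak A$ the multiplication map, and let $\mathfrak A$ act by $a\cdot(b\otimes c)=(ab)\otimes c$ and $(b\otimes c)\cdot a=b\otimes(ca)$. A *bounded approximate diagonal* is a bounded net $(D_\alpha)$ in $\mathfrak A\otimes^\gamma\mathfrak A$ with $a\,m(D_\alpha)\to a$, $m(D_\alpha)\,a\to a$ and $a\cdot D_\alpha-D_\alpha\cdot a\to 0$ for each $a\in\mathfrak A$; the *amenability constant* is $$\mathrm{AM}(\mathfrak A)=\inf\Bigl\{\sup_\alpha\|D_\alpha\|_\gamma : (D_\alpha)\text{ is a bounded approximate diagonal for }\mathfrak A\Bigr\}\in[0,\infty]\qquad(\inf\varnothing=\infty).$$ $\mathfrak A$ is *contractible* if it admits a *diagonal*, i.e. some $D\in\mathfrak A\otimes^\gamma\mathfrak A$ with $a\,m(D)=a=m(D)\,a$ and $a\cdot D=D\cdot a$ for all $a\in\mathfrak A$. Let $n\ge 0$ be an integer and let $L_n=\{0,1,\dots,n\}$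 be the linear semilattice with product $st=\min\{s,t\}$. Let $\mathfrak A$ be a Banach algebra graded over $L_n$, i.e. there are closed subspaces $\mathfrak A_k$ $(k\in L_n)$ with $\mathfrak A=\ell^1\text{-}\bigoplus_{k\in L_n}\mathfrak A_k$ and $\mathfrak A_s\mathfrak A_t\subseteq\mathfrak A_{st}$ for $s,t\in L_n$. Suppose that: * (LA1) for each $s\in L_n$ there is a bounded approximate identity $(u_{s,\alpha})_\alpha$ in $\mathfrak A_s$ such that $\lim_\alpha u_{s,\alpha}a_t=a_t=\lim_\alpha a_tu_{s,\alpha}$ for each $t\le s$ and $a_t\in\mathfrak A_t$; * each $\mathfrak A_k$ $(k\in L_n)$ is contractible with $\mathrm{AM}(\mathfrak A_k)=1$. Then $\mathrm{AM}(\mathfrak A)=4n+1$. -/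

import Mathlib

open Filter Topology
open scoped TensorProduct ENNReal

set_option linter.unusedSectionVars false

noncomputable section

/-! ## The projective tensor product of two complex Banach spaces -/

namespace Projective

universe u v w

/-- The algebraic tensor product `E ⊗ F` over `ℂ`, as a type synonym that will carry
the projective (semi)norm. -/
def AlgTensor (E : Type u) (F : Type v) [NormedAddCommGroup E] [NormedSpace ℂ E]
    [NormedAddCommGroup F] [NormedSpace ℂ F] : Type (max u v) :=
  E ⊗[ℂ] F

section

variable (E : Type u) (F : Type v) [NormedAddCommGroup E] [NormedSpace ℂ E]
  [NormedAddCommGroup F] [NormedSpace ℂ F]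

instance : AddCommGroup (AlgTensor E F) := inferInstanceAs (AddCommGroup (E ⊗[ℂ] F))

instance : Module ℂ (AlgTensor E F) := inferInstanceAs (Module ℂ (E ⊗[ℂ] F))

variable {E F}

/-- The elementary tensor `x ⊗ y` in the algebraic tensor product. -/
def mk (x : E) (y : F) : AlgTensor E F := (x ⊗ₜ[ℂ] y : E ⊗[ℂ] F)

theorem mk_add (x : E) (y y' : F) : mk x (y + y') = mk x y + mk x y' :=
  TensorProduct.tmul_add x y y'

theorem add_mk (x x' : E) (y : F) : mk (x + x') y = mk x y + mk x' y :=
  TensorProduct.add_tmul x x' y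

theorem smul_mk (c : ℂ) (x : E) (y : F) : mk (c • x) y = c • mk x y :=
  (TensorProduct.smul_tmul' c x y).symm

theorem mk_smul (c : ℂ) (x : E) (y : F) : mk x (c • y) = c • mk x y :=
  TensorProduct.tmul_smul c x y

/-- The element `∑ᵢ xᵢ ⊗ yᵢ` of `E ⊗ F` given by a finite list of pairs `(xᵢ, yᵢ)`. -/
def listSum (l : List (E × F)) : AlgTensor E F :=
  (l.map fun p => mk p.1 p.2).sum

/-- The cost `∑ᵢ ‖xᵢ‖ ‖yᵢ‖` of a finite list of pairs `(xᵢ, yᵢ)`. -/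
def listCost (l : List (E × F)) : ℝ := (l.map fun p => ‖p.1‖ * ‖p.2‖).sum

theorem listCost_nonneg (l : List (E × F)) : 0 ≤ listCost l := by
  refine List.sum_nonneg fun x hx => ?_
  obtain ⟨p, -, rfl⟩ := List.mem_map.1 hx
  positivity

theorem listSum_append (l l' : List (E × F)) :
    listSum (l ++ l') = listSum l + listSum l' := by
  simp [listSum]

theorem listCost_append (l l' : List (E × F)) :
    listCost (l ++ l') = listCost l + listCost l' := by
  simp [listCost]

theorem listSum_smul (c : ℂ) (l : List (E × F)) :
    listSum (l.map fun p => (c • p.1, p.2)) = c • listSum l := by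
  simp [listSum, List.smul_sum, Function.comp_def, smul_mk]

theorem listCost_smul (c : ℂ) (l : List (E × F)) :
    listCost (l.map fun p => (c • p.1, p.2)) = ‖c‖ * listCost l := by
  simp only [listCost, List.map_map]
  rw [← List.sum_map_mul_left]
  congr 1
  refine List.map_congr_left fun p _ => ?_
  simp [norm_smul, mul_assoc]

theorem exists_listSum (t : AlgTensor E F) : ∃ l : List (E × F), listSum l = t := by
  induction t using TensorProduct.induction_on with
  | zero => exact ⟨[], rfl⟩
  | tmul x y => exact ⟨[(x, y)], by simp [listSum]; rfl⟩
  | add a b ha hb =>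
    obtain ⟨l, hl⟩ := ha
    obtain ⟨l', hl'⟩ := hb
    exact ⟨l ++ l', by rw [listSum_append, hl, hl']; rfl⟩

/-- The set of costs of all finite representations `t = ∑ᵢ xᵢ ⊗ yᵢ`. -/
def costs (t : AlgTensor E F) : Set ℝ := {r | ∃ l : List (E × F), listSum l = t ∧ r = listCost l}

theorem costs_nonempty (t : AlgTensor E F) : (costs t).Nonempty :=
  let ⟨l, hl⟩ := exists_listSum t
  ⟨_, l, hl, rfl⟩

theorem costs_bddBelow (t : AlgTensor E F) : BddBelow (costs t) :=
  ⟨0, by rintro _ ⟨l, -, rfl⟩; exact listCost_nonneg l⟩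

/-- The projective norm `‖t‖ = inf {∑ᵢ ‖xᵢ‖ ‖yᵢ‖ : t = ∑ᵢ xᵢ ⊗ yᵢ}`. -/
instance : Norm (AlgTensor E F) := ⟨fun t => sInf (costs t)⟩

theorem norm_listSum_le (l : List (E × F)) : ‖listSum l‖ ≤ listCost l :=
  csInf_le (costs_bddBelow _) ⟨l, rfl, rfl⟩

theorem exists_listCost_lt {t : AlgTensor E F} {r : ℝ} (h : ‖t‖ < r) :
    ∃ l : List (E × F), listSum l = t ∧ listCost l < r := by
  obtain ⟨_, ⟨l, hl, rfl⟩, hr⟩ := exists_lt_of_csInf_lt (costs_nonempty t) h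
  exact ⟨l, hl, hr⟩

theorem norm_smul_le_aux (c : ℂ) (t : AlgTensor E F) : ‖c • t‖ ≤ ‖c‖ * ‖t‖ := by
  refine le_of_forall_pos_lt_add fun ε hε => ?_
  have hpos : 0 < ‖c‖ + 1 := by positivity
  obtain ⟨l, hl, hlt⟩ := exists_listCost_lt (t := t) (r := ‖t‖ + ε / (‖c‖ + 1))
    (lt_add_of_pos_right _ (by positivity))
  have h1 := norm_listSum_le (l.map fun p => (c • p.1, p.2))
  rw [listSum_smul, listCost_smul, hl] at h1
  have h2 : ‖c‖ * listCost l ≤ ‖c‖ * (‖t‖ + ε / (‖c‖ + 1)) :=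
    mul_le_mul_of_nonneg_left hlt.le (norm_nonneg c)
  have h3 : ‖c‖ * (ε / (‖c‖ + 1)) < ε := by
    rw [← mul_div_assoc, div_lt_iff₀ hpos]
    nlinarith [norm_nonneg c]
  linarith

theorem seminormedCore : SeminormedSpace.Core ℂ (AlgTensor E F) where
  norm_nonneg t := by
    refine le_csInf (costs_nonempty t) ?_
    rintro _ ⟨l, -, rfl⟩
    exact listCost_nonneg l
  norm_smul c t := by
    refine le_antisymm (norm_smul_le_aux c t) ?_
    rcases eq_or_ne c 0 with rfl | hc
    · rw [norm_zero, zero_mul]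
      refine le_csInf (costs_nonempty _) ?_
      rintro _ ⟨l, -, rfl⟩
      exact listCost_nonneg l
    · have h := norm_smul_le_aux c⁻¹ (c • t)
      rw [smul_smul, inv_mul_cancel₀ hc, one_smul, norm_inv] at h
      rwa [inv_mul_eq_div, le_div_iff₀' (norm_pos_iff.2 hc)] at h
  norm_triangle s t := by
    refine le_of_forall_pos_lt_add fun ε hε => ?_
    obtain ⟨l, hl, hlt⟩ := exists_listCost_lt (t := s) (r := ‖s‖ + ε / 2)
      (lt_add_of_pos_right _ (by positivity))
    obtain ⟨l', hl', hlt'⟩ := exists_listCost_lt (t := t) (r := ‖t‖ + ε / 2)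
      (lt_add_of_pos_right _ (by positivity))
    have h := norm_listSum_le (l ++ l')
    rw [listSum_append, listCost_append, hl, hl'] at h
    linarith

instance : SeminormedAddCommGroup (AlgTensor E F) :=
  SeminormedAddCommGroup.ofCore seminormedCore

instance : NormedSpace ℂ (AlgTensor E F) :=
  { (inferInstance : Module ℂ (AlgTensor E F)) with
    norm_smul_le := norm_smul_le_aux }

end

/-- The projective tensor product `E ⊗^γ F`: the completion of the algebraic tensor product
for the projective norm. -/
abbrev PTensor (E : Type u) (F : Type v) [NormedAddCommGroup E] [NormedSpace ℂ E]
    [NormedAddCommGroup F] [NormedSpace ℂ F] : Type (max u v) :=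
  UniformSpace.Completion (AlgTensor E F)

section

variable {E : Type u} {F : Type v} {G : Type w}
  [NormedAddCommGroup E] [NormedSpace ℂ E] [NormedAddCommGroup F] [NormedSpace ℂ F]
  [NormedAddCommGroup G] [NormedSpace ℂ G]

/-- The elementary tensor `x ⊗ y` in `E ⊗^γ F`. -/
def tmul (x : E) (y : F) : PTensor E F :=
  UniformSpace.Completion.toComplL (𝕜 := ℂ) (mk x y)

/-- The linear map on the algebraic tensor product induced by a bounded bilinear map. -/
def liftAlg (B : E →L[ℂ] F →L[ℂ] G) : AlgTensor E F →ₗ[ℂ] G :=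
  TensorProduct.lift
    (LinearMap.mk₂ ℂ (fun x y => B x y) (by simp) (by simp) (by simp) (by simp))

theorem liftAlg_listSum (B : E →L[ℂ] F →L[ℂ] G) (l : List (E × F)) :
    liftAlg B (listSum l) = (l.map fun p => B p.1 p.2).sum := by
  induction l with
  | nil => exact map_zero (liftAlg B)
  | cons p l ih =>
    have h1 : listSum (p :: l) = listSum [p] + listSum l := listSum_append [p] l
    have h2 : liftAlg B (listSum [p]) = B p.1 p.2 := by
      simp only [listSum, List.map_cons, List.map_nil, List.sum_cons, List.sum_nil, add_zero]
      exact TensorProduct.lift.tmul _ _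
    rw [h1, map_add, h2, ih, List.map_cons, List.sum_cons]

theorem norm_liftAlg_le (B : E →L[ℂ] F →L[ℂ] G) (t : AlgTensor E F) :
    ‖liftAlg B t‖ ≤ ‖B‖ * ‖t‖ := by
  have key : ∀ l : List (E × F), ‖liftAlg B (listSum l)‖ ≤ ‖B‖ * listCost l := by
    intro l
    rw [liftAlg_listSum]
    induction l with
    | nil => simp [listCost]
    | cons p l ih =>
      simp only [listCost, List.map_cons, List.sum_cons] at ih ⊢
      refine (norm_add_le _ _).trans ?_
      have := B.le_opNorm₂ p.1 p.2
      linarith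
  refine le_of_forall_pos_lt_add fun ε hε => ?_
  have hpos : 0 < ‖B‖ + 1 := by positivity
  obtain ⟨l, rfl, hlt⟩ := exists_listCost_lt (t := t) (r := ‖t‖ + ε / (‖B‖ + 1))
    (lt_add_of_pos_right _ (by positivity))
  have h1 := key l
  have h2 : ‖B‖ * listCost l ≤ ‖B‖ * (‖listSum l‖ + ε / (‖B‖ + 1)) :=
    mul_le_mul_of_nonneg_left hlt.le (norm_nonneg B)
  have h3 : ‖B‖ * (ε / (‖B‖ + 1)) < ε := by
    rw [← mul_div_assoc, div_lt_iff₀ hpos]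
    nlinarith [norm_nonneg B]
  linarith

/-- The bounded linear map `E ⊗^γ F → G` with `x ⊗ y ↦ B x y`, for a bounded bilinear map `B`
with values in a Banach space. -/
def lift [CompleteSpace G] (B : E →L[ℂ] F →L[ℂ] G) : PTensor E F →L[ℂ] G :=
  ((liftAlg B).mkContinuous ‖B‖ (norm_liftAlg_le B)).extend
    (UniformSpace.Completion.toComplL : AlgTensor E F →L[ℂ] PTensor E F)

@[simp]
theorem lift_tmul [CompleteSpace G] (B : E →L[ℂ] F →L[ℂ] G) (x : E) (y : F) :
    lift B (tmul x y) = B x y := by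
  have h := ContinuousLinearMap.extend_eq
    ((liftAlg B).mkContinuous ‖B‖ (norm_liftAlg_le B))
    (e := (UniformSpace.Completion.toComplL : AlgTensor E F →L[ℂ] PTensor E F))
    (UniformSpace.Completion.denseRange_coe)
    (UniformSpace.Completion.isUniformInducing_coe _)
    (mk x y)
  refine h.trans ?_
  exact TensorProduct.lift.tmul _ _

theorem norm_tmul_le (x : E) (y : F) : ‖tmul x y‖ ≤ ‖x‖ * ‖y‖ := by
  have h := norm_listSum_le [(x, y)]
  simp only [listSum, listCost, List.map_cons, List.map_nil, List.sum_cons, List.sum_nil,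
    add_zero] at h
  exact (UniformSpace.Completion.norm_coe _).trans_le h

theorem tmul_add (x : E) (y y' : F) : tmul x (y + y') = tmul x y + tmul x y' := by
  rw [tmul, mk_add, map_add]; rfl

theorem add_tmul (x x' : E) (y : F) : tmul (x + x') y = tmul x y + tmul x' y := by
  rw [tmul, add_mk, map_add]; rfl

theorem smul_tmul (c : ℂ) (x : E) (y : F) : tmul (c • x) y = c • tmul x y := by
  rw [tmul, smul_mk, map_smul]; rfl

theorem tmul_smul (c : ℂ) (x : E) (y : F) : tmul x (c • y) = c • tmul x y := by
  rw [tmul, mk_smul, map_smul]; rfl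

variable (E F) in
/-- The bounded bilinear map `(x, y) ↦ x ⊗ y` into the projective tensor product. -/
def tmulL : E →L[ℂ] F →L[ℂ] PTensor E F :=
  (LinearMap.mk₂ ℂ (fun (x : E) (y : F) => tmul x y)
    add_tmul smul_tmul tmul_add tmul_smul).mkContinuous₂ 1 fun x y => by
      simpa using norm_tmul_le x y

@[simp]
theorem tmulL_apply (x : E) (y : F) : tmulL E F x y = tmul x y := rfl

end

end Projective

/-! ## Diagonals and the amenability constant of a complex Banach algebra -/

namespace Amenability

open Projective

universe u

section

variable (A : Type u) [NonUnitalNormedRing A] [NormedSpace ℂ A] [IsScalarTower ℂ A A]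
  [SMulCommClass ℂ A A]

/-- The multiplication map `m : A ⊗^γ A → A`, `m (b ⊗ c) = b c`. -/
def mulMap [CompleteSpace A] : PTensor A A →L[ℂ] A :=
  lift (ContinuousLinearMap.mul ℂ A)

variable {A}

/-- The left action of `a ∈ A` on `A ⊗^γ A`: `a · (b ⊗ c) = (a b) ⊗ c`. -/
def leftAct (a : A) : PTensor A A →L[ℂ] PTensor A A :=
  lift ((tmulL A A).comp (ContinuousLinearMap.mul ℂ A a))

/-- The right action of `a ∈ A` on `A ⊗^γ A`: `(b ⊗ c) · a = b ⊗ (c a)`. -/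
def rightAct (a : A) : PTensor A A →L[ℂ] PTensor A A :=
  lift ((tmulL A A).flip.comp ((ContinuousLinearMap.mul ℂ A).flip a)).flip

@[simp]
theorem mulMap_tmul [CompleteSpace A] (b c : A) : mulMap A (tmul b c) = b * c := by
  simp [mulMap]

@[simp]
theorem leftAct_tmul (a b c : A) : leftAct a (tmul b c) = tmul (a * b) c := by
  simp [leftAct]

@[simp]
theorem rightAct_tmul (a b c : A) : rightAct a (tmul b c) = tmul b (c * a) := by
  simp [rightAct]

/-- `D ∈ A ⊗^γ A` is a diagonal for `A`. -/
structure IsDiagonal [CompleteSpace A] (D : PTensor A A) : Prop where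
  mul_mulMap : ∀ a : A, a * mulMap A D = a
  mulMap_mul : ∀ a : A, mulMap A D * a = a
  central : ∀ a : A, leftAct a D = rightAct a D

variable (A) in
/-- A Banach algebra is contractible if it admits a diagonal. -/
def IsContractible [CompleteSpace A] : Prop := ∃ D : PTensor A A, IsDiagonal D

/-- The net `D` (indexed by a directed set `ι`) is a bounded approximate diagonal for `A`. -/
structure IsBoundedApproxDiagonal [CompleteSpace A] {ι : Type u} [Preorder ι]
    (D : ι → PTensor A A) : Prop where
  bounded : ∃ C : ℝ, ∀ i, ‖D i‖ ≤ C
  tendsto_mul_mulMap : ∀ a : A, Tendsto (fun i => a * mulMap A (D i)) atTop (𝓝 a)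
  tendsto_mulMap_mul : ∀ a : A, Tendsto (fun i => mulMap A (D i) * a) atTop (𝓝 a)
  tendsto_central : ∀ a : A, Tendsto (fun i => leftAct a (D i) - rightAct a (D i)) atTop (𝓝 0)

variable (A) in
/-- The amenability constant `AM(A)`: the infimum of `sup_α ‖D_α‖` over all bounded approximate
diagonals `(D_α)` of `A`, indexed by arbitrary non-empty directed sets. It is a number in
`[0, ∞]`, equal to `∞` exactly when there is no bounded approximate diagonal. (Directed sets in
the universe of `A` suffice: every such net can be reindexed by `Finset A × ℕ` without
increasing its supremum.) -/
def amenabilityConstant [CompleteSpace A] : ℝ≥0∞ :=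
  sInf {c | ∃ (ι : Type u) (_ : Preorder ι) (_ : IsDirectedOrder ι) (_ : Nonempty ι)
    (D : ι → PTensor A A), IsBoundedApproxDiagonal D ∧ c = ⨆ i, ‖D i‖ₑ}

end

/-! ## Gradings over finite semilattices

A semilattice is written as a `SemilatticeInf`: the product of `s` and `t` is `s ⊓ t`, and
`s ≤ t` means `s ⊓ t = s`. -/

section

variable {A : Type u} [NonUnitalNormedRing A] [NormedSpace ℂ A]
  {S : Type*} [SemilatticeInf S] [Fintype S] [DecidableEq S]

/-- The Banach algebra `A` is graded over the finite semilattice `S`, with components `𝔄 s`: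
these are closed subspaces, `A` is their internal `ℓ¹`-direct sum, and `𝔄 s * 𝔄 t ⊆ 𝔄 (s ⊓ t)`. -/
structure IsGraded (𝔄 : S → Submodule ℂ A) : Prop where
  isClosed : ∀ s, IsClosed (𝔄 s : Set A)
  isInternal : DirectSum.IsInternal 𝔄
  norm_sum : ∀ x : (s : S) → 𝔄 s, ‖∑ s, (x s : A)‖ = ∑ s, ‖x s‖
  mul_mem : ∀ (s t : S) (a b : A), a ∈ 𝔄 s → b ∈ 𝔄 t → a * b ∈ 𝔄 (s ⊓ t)

/-- The component `𝔄 s` of a graded Banach algebra as a subalgebra of `A` (with the norm of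
`A`); it is closed under products because `s ⊓ s = s`. -/
def IsGraded.component {𝔄 : S → Submodule ℂ A} (h : IsGraded 𝔄) (s : S) :
    NonUnitalSubalgebra ℂ A :=
  { 𝔄 s with mul_mem' := fun {a b} ha hb => by simpa using h.mul_mem s s a b ha hb }

/-- A subalgebra is a normed space with the restricted norm. -/
instance (B : NonUnitalSubalgebra ℂ A) : NormedSpace ℂ B where
  norm_smul_le c x := norm_smul_le c (x : A)

instance {𝔄 : S → Submodule ℂ A} (h : IsGraded 𝔄) (s : S) [CompleteSpace A] :
    CompleteSpace (h.component s) :=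
  (h.isClosed s).completeSpace_coe

/-- The first linking assumption (LA1): for each `s` there is a bounded approximate identity
`(u_α)` in `𝔄 s` such that `u_α a → a` and `a u_α → a` for all `t ≤ s` and `a ∈ 𝔄 t`
(the case `t = s` says that it is an approximate identity of `𝔄 s`). -/
def LA1 (𝔄 : S → Submodule ℂ A) : Prop :=
  ∀ s : S, ∃ (ι : Type u) (_ : Preorder ι) (_ : IsDirectedOrder ι) (_ : Nonempty ι) (e : ι → A),
    (∀ i, e i ∈ 𝔄 s) ∧ (∃ C : ℝ, ∀ i, ‖e i‖ ≤ C) ∧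
      ∀ t ≤ s, ∀ a ∈ 𝔄 t,
        Tendsto (fun i => e i * a) atTop (𝓝 a) ∧ Tendsto (fun i => a * e i) atTop (𝓝 a)

end

end Amenability

end

/-! ### Bounded maps out of the projective tensor product. -/

namespace Projective

section

variable {E F G : Type*} [NormedAddCommGroup E] [NormedSpace ℂ E] [NormedAddCommGroup F]
  [NormedSpace ℂ F] [NormedAddCommGroup G] [NormedSpace ℂ G]

/-! Each component `𝔄 k` has a unit `e k` of norm one, which by (LA1) also acts as a unit on the
lower components. The differences g_k = e_k - e_{k-1}, with g_0 = e_0, are central idempotents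
summing to the unit e_n of `A`, and g_k A = g_k 𝔄_k.

Upper bound: for approximate diagonals D_k of `𝔄 k` of norm at most c, the sum of the g_k · D_k ·
g_k is an approximate diagonal of `A`. Its norm is at most c ∑ ‖g_k‖² ≤ (4n + 1)c, because ‖g_0‖ = 1
and ‖g_k‖ ≤ 2 otherwise. Let c decrease to 1 (`IsUnitSystem.amenabilityConstant_le`).

Lower bound: let f_k be a functional of norm one with f_k(e_k) = 1, and put F(x, y) = ∑ (-1)^{s+t}
f_{min(s,t)}(x_s y_t). The ℓ¹-norm gives ‖F‖ ≤ 1. The signs give F(g_k, g_k) = 4 for k ≥ 1, and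
F(g_0, g_0) = 1. On tensors g_k x ⊗ y g_k the form depends only on the product xy
(`exists_bilinear_form`). Hence along any bounded approximate diagonal F(D_i) tends to ∑ F(g_k, g_k)
= 4n + 1, which forces the supremum of ‖D_i‖ to be at least 4n + 1 (`le_amenabilityConstant`). -/

theorem norm_lift_apply_le [CompleteSpace G] (B : E →L[ℂ] F →L[ℂ] G) (t : PTensor E F) :
    ‖lift B t‖ ≤ ‖B‖ * ‖t‖ := by
  induction t using UniformSpace.Completion.induction_on with
  | hp => exact isClosed_le (by fun_prop) (by fun_prop)
  | ih a =>
    have h : lift B (a : PTensor E F) = liftAlg B a :=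
      ContinuousLinearMap.extend_eq
        ((liftAlg B).mkContinuous ‖B‖ (norm_liftAlg_le B))
        (e := (UniformSpace.Completion.toComplL : AlgTensor E F →L[ℂ] PTensor E F))
        (UniformSpace.Completion.denseRange_coe)
        (UniformSpace.Completion.isUniformInducing_coe _) a
    rw [h, UniformSpace.Completion.norm_coe]
    exact norm_liftAlg_le B a

/-- Elementary tensors span a dense subspace. The bimodule identities below are all reduced to
elementary tensors in this way. -/
theorem ext_tmul {T T' : PTensor E F →L[ℂ] G} (h : ∀ x y, T (tmul x y) = T' (tmul x y)) :
    T = T' := by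
  ext t
  induction t using UniformSpace.Completion.induction_on with
  | hp => exact isClosed_eq T.continuous T'.continuous
  | ih a =>
    obtain ⟨l, rfl⟩ := exists_listSum a
    induction l with
    | nil =>
      have h0 : ((listSum ([] : List (E × F)) : AlgTensor E F) : PTensor E F) = 0 :=
        UniformSpace.Completion.coe_zero
      rw [h0, map_zero, map_zero]
    | cons p l ih =>
      have h1 : ((listSum (p :: l) : AlgTensor E F) : PTensor E F)
          = tmul p.1 p.2 + (listSum l : AlgTensor E F) :=
        UniformSpace.Completion.coe_add (mk p.1 p.2) (listSum l)
      rw [h1, map_add, map_add, ih, h]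

theorem norm_lift_apply_le_of_bound [CompleteSpace G] {B : E →L[ℂ] F →L[ℂ] G} {C : ℝ}
    (hC : 0 ≤ C) (hB : ∀ x y, ‖B x y‖ ≤ C * ‖x‖ * ‖y‖) (t : PTensor E F) :
    ‖lift B t‖ ≤ C * ‖t‖ :=
  (norm_lift_apply_le B t).trans
    (mul_le_mul_of_nonneg_right (B.opNorm_le_bound₂ hC hB) (norm_nonneg t))

end

end Projective

/-! ### The bimodule `A ⊗^γ A` and its functoriality for subalgebras. -/

namespace Amenability

open Projective

universe u

section

variable {A : Type u} [NonUnitalNormedRing A] [NormedSpace ℂ A] [IsScalarTower ℂ A A]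
  [SMulCommClass ℂ A A]

theorem norm_mulMap_le [CompleteSpace A] (D : PTensor A A) : ‖mulMap A D‖ ≤ ‖D‖ := by
  have := norm_lift_apply_le_of_bound (B := ContinuousLinearMap.mul ℂ A) zero_le_one
    (fun x y => by simpa using norm_mul_le x y) D
  simpa [mulMap] using this

theorem norm_leftAct_le (a : A) (D : PTensor A A) : ‖leftAct a D‖ ≤ ‖a‖ * ‖D‖ :=
  norm_lift_apply_le_of_bound (norm_nonneg a) (fun x y =>
    (norm_tmul_le (a * x) y).trans (by gcongr; exact norm_mul_le a x)) D

theorem norm_rightAct_le (a : A) (D : PTensor A A) : ‖rightAct a D‖ ≤ ‖a‖ * ‖D‖ :=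
  norm_lift_apply_le_of_bound (norm_nonneg a) (fun x y =>
    (norm_tmul_le x (y * a)).trans (by
      rw [mul_comm ‖a‖, mul_assoc, mul_comm ‖a‖]; gcongr; exact norm_mul_le y a)) D

theorem leftAct_leftAct (a b : A) (D : PTensor A A) :
    leftAct a (leftAct b D) = leftAct (a * b) D := by
  have : (leftAct a).comp (leftAct b) = leftAct (a * b) :=
    ext_tmul fun x y => by simp [mul_assoc]
  exact congr($this D)

theorem rightAct_rightAct (a b : A) (D : PTensor A A) :
    rightAct a (rightAct b D) = rightAct (b * a) D := by
  have : (rightAct a).comp (rightAct b) = rightAct (b * a) :=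
    ext_tmul fun x y => by simp [mul_assoc]
  exact congr($this D)

theorem leftAct_rightAct (a b : A) (D : PTensor A A) :
    leftAct a (rightAct b D) = rightAct b (leftAct a D) := by
  have : (leftAct a).comp (rightAct b) = (rightAct b).comp (leftAct a) :=
    ext_tmul fun x y => by simp
  exact congr($this D)

theorem leftAct_add (a b : A) (D : PTensor A A) :
    leftAct (a + b) D = leftAct a D + leftAct b D := by
  have : leftAct (a + b) = leftAct a + leftAct b :=
    ext_tmul fun x y => by simp [add_mul, add_tmul]
  exact congr($this D)

theorem leftAct_sum {ι : Type*} (s : Finset ι) (p : ι → A) (D : PTensor A A) :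
    leftAct (∑ k ∈ s, p k) D = ∑ k ∈ s, leftAct (p k) D :=
  map_sum (AddMonoidHom.mk' (fun a => leftAct a D) fun a b => leftAct_add a b D) p s

theorem leftAct_of_forall_mul_eq {e : A} (he : ∀ a, e * a = a) (D : PTensor A A) :
    leftAct e D = D := by
  have : leftAct e = ContinuousLinearMap.id ℂ (PTensor A A) :=
    ext_tmul fun x y => by simp [he]
  exact congr($this D)

theorem mulMap_leftAct [CompleteSpace A] (a : A) (D : PTensor A A) :
    mulMap A (leftAct a D) = a * mulMap A D := by
  have : (mulMap A).comp (leftAct a) = (ContinuousLinearMap.mul ℂ A a).comp (mulMap A) :=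
    ext_tmul fun x y => by simp [mul_assoc]
  exact congr($this D)

theorem mulMap_rightAct [CompleteSpace A] (a : A) (D : PTensor A A) :
    mulMap A (rightAct a D) = mulMap A D * a := by
  have : (mulMap A).comp (rightAct a)
      = ((ContinuousLinearMap.mul ℂ A).flip a).comp (mulMap A) :=
    ext_tmul fun x y => by simp [mul_assoc]
  exact congr($this D)

/-- The inclusion of a subalgebra as a bounded linear map. -/
noncomputable def subalgebraIncl (B : NonUnitalSubalgebra ℂ A) : B →L[ℂ] A :=
  LinearMap.mkContinuous ⟨⟨fun x => (x : A), fun _ _ => rfl⟩, fun _ _ => rfl⟩ 1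
    fun x => (one_mul ‖x‖).ge

@[simp]
theorem subalgebraIncl_apply (B : NonUnitalSubalgebra ℂ A) (x : B) :
    subalgebraIncl B x = x := rfl

/-- The canonical map `B ⊗^γ B → A ⊗^γ A` for a subalgebra `B` of `A`. -/
noncomputable def tensorIncl (B : NonUnitalSubalgebra ℂ A) : PTensor B B →L[ℂ] PTensor A A :=
  lift ((tmulL A A).bilinearComp (subalgebraIncl B) (subalgebraIncl B))

@[simp]
theorem tensorIncl_tmul (B : NonUnitalSubalgebra ℂ A) (x y : B) :
    tensorIncl B (tmul x y) = tmul (x : A) (y : A) := by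
  simp [tensorIncl]

theorem norm_tensorIncl_le (B : NonUnitalSubalgebra ℂ A) (D : PTensor B B) :
    ‖tensorIncl B D‖ ≤ ‖D‖ := by
  have := norm_lift_apply_le_of_bound
    (B := (tmulL A A).bilinearComp (subalgebraIncl B) (subalgebraIncl B)) zero_le_one
    (fun x y => by rw [one_mul]; exact norm_tmul_le (x : A) (y : A)) D
  simpa [tensorIncl] using this

theorem tensorIncl_leftAct (B : NonUnitalSubalgebra ℂ A) (b : B) (D : PTensor B B) :
    tensorIncl B (leftAct b D) = leftAct (b : A) (tensorIncl B D) := by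
  have : (tensorIncl B).comp (leftAct b) = (leftAct (b : A)).comp (tensorIncl B) :=
    ext_tmul fun x y => by simp
  exact congr($this D)

theorem tensorIncl_rightAct (B : NonUnitalSubalgebra ℂ A) (b : B) (D : PTensor B B) :
    tensorIncl B (rightAct b D) = rightAct (b : A) (tensorIncl B D) := by
  have : (tensorIncl B).comp (rightAct b) = (rightAct (b : A)).comp (tensorIncl B) :=
    ext_tmul fun x y => by simp
  exact congr($this D)

theorem mulMap_tensorIncl [CompleteSpace A] (B : NonUnitalSubalgebra ℂ A) [CompleteSpace B]
    (D : PTensor B B) : mulMap A (tensorIncl B D) = mulMap B D := by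
  have : (mulMap A).comp (tensorIncl B) = (subalgebraIncl B).comp (mulMap B) :=
    ext_tmul fun x y => by simp
  exact congr($this D)

/-- The unit of a contractible Banach algebra. -/
theorem IsContractible.exists_unit [CompleteSpace A] (h : IsContractible A) :
    ∃ e : A, ∀ a, e * a = a ∧ a * e = a :=
  let ⟨D, hD⟩ := h
  ⟨mulMap A D, fun a => ⟨hD.mulMap_mul a, hD.mul_mulMap a⟩⟩

/-! ### Nets and units controlled by the amenability constant. -/

theorem exists_isBoundedApproxDiagonal_of_lt [CompleteSpace A] {c : ℝ}
    (hc : amenabilityConstant A < ENNReal.ofReal c) :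
    ∃ (ι : Type u) (_ : Preorder ι) (_ : IsDirectedOrder ι) (_ : Nonempty ι)
      (D : ι → PTensor A A), IsBoundedApproxDiagonal D ∧ ∀ i, ‖D i‖ ≤ c := by
  obtain ⟨_, ⟨ι, i₁, i₂, i₃, D, hD, rfl⟩, hlt⟩ := sInf_lt_iff.1 hc
  refine ⟨ι, i₁, i₂, i₃, D, hD, fun i => ?_⟩
  have h := (le_iSup (fun i => ‖D i‖ₑ) i).trans_lt hlt
  rw [← ofReal_norm] at h
  exact (ENNReal.ofReal_lt_ofReal_iff'.1 h).1.le

theorem amenabilityConstant_le [CompleteSpace A] {ι : Type u} [Preorder ι] [IsDirectedOrder ι]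
    [Nonempty ι] {D : ι → PTensor A A} (hD : IsBoundedApproxDiagonal D) {c : ℝ}
    (hc : ∀ i, ‖D i‖ ≤ c) : amenabilityConstant A ≤ ENNReal.ofReal c := by
  have hle : amenabilityConstant A ≤ ⨆ i, ‖D i‖ₑ :=
    sInf_le ⟨ι, inferInstance, inferInstance, inferInstance, D, hD, rfl⟩
  refine hle.trans (iSup_le fun i => ?_)
  rw [← ofReal_norm]
  exact ENNReal.ofReal_le_ofReal (hc i)

/-- The unit is the limit of m(D_i) e = m(D_i), and m is contractive. -/
theorem norm_unit_le_of_amenabilityConstant_le_one [CompleteSpace A]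
    (h : amenabilityConstant A ≤ 1) {e : A} (he : ∀ a, e * a = a ∧ a * e = a) : ‖e‖ ≤ 1 := by
  refine le_of_forall_gt_imp_ge_of_dense fun c hc => ?_
  have hlt : amenabilityConstant A < ENNReal.ofReal c :=
    h.trans_lt (by simpa using hc)
  obtain ⟨ι, _, _, _, D, hD, hb⟩ := exists_isBoundedApproxDiagonal_of_lt hlt
  have ht := hD.tendsto_mulMap_mul e
  simp only [(he _).2] at ht
  exact le_of_tendsto ht.norm (Eventually.of_forall fun i => (norm_mulMap_le _).trans (hb i))

/-- This excludes the zero algebra when the constant is 1, so that the unit is nonzero and e = e²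
forces ‖e‖ ≥ 1. -/
theorem amenabilityConstant_eq_zero_of_subsingleton [CompleteSpace A] [Subsingleton A] :
    amenabilityConstant A = 0 := by
  have : IsBoundedApproxDiagonal (fun _ : PUnit.{u + 1} => (0 : PTensor A A)) :=
    ⟨⟨0, by simp⟩, fun a => by simp [Subsingleton.elim a 0], fun a => by
      simp [Subsingleton.elim a 0], fun a => by simp⟩
  simpa using amenabilityConstant_le this (c := 0) (by simp)

theorem norm_unit_eq_one [CompleteSpace A] (h : amenabilityConstant A = 1) {e : A}
    (he : ∀ a, e * a = a ∧ a * e = a) : ‖e‖ = 1 := by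
  refine le_antisymm (norm_unit_le_of_amenabilityConstant_le_one h.le he) ?_
  have h0 : e ≠ 0 := by
    rintro rfl
    have : Subsingleton A := ⟨fun a b => by rw [← (he a).1, ← (he b).1, zero_mul, zero_mul]⟩
    simp [amenabilityConstant_eq_zero_of_subsingleton] at h
  have h1 := norm_mul_le e e
  rw [(he e).1] at h1
  exact (le_mul_iff_one_le_left (norm_pos_iff.2 h0)).1 h1

end

/-! ### Coordinates in a graded algebra. -/

section

variable {A : Type u} [NonUnitalNormedRing A] [NormedSpace ℂ A]
  {S : Type*} [SemilatticeInf S] [Fintype S] [DecidableEq S]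

/-- The coordinate projections of a graded Banach algebra. -/
theorem IsGraded.exists_proj {𝔄 : S → Submodule ℂ A} (h : IsGraded 𝔄) :
    ∃ P : S → A →L[ℂ] A, (∀ s x, P s x ∈ 𝔄 s) ∧ (∀ x, ∑ s, P s x = x) ∧
      (∀ x, ∑ s, ‖P s x‖ = ‖x‖) ∧ (∀ s t, ∀ a ∈ 𝔄 t, P s a = if s = t then a else 0) := by
  classical
  have : Function.Bijective (DirectSum.coeLinearMap 𝔄) := h.isInternal
  let e := (LinearEquiv.ofBijective (DirectSum.coeLinearMap 𝔄) this).symm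
  let Q : S → A →ₗ[ℂ] A := fun s =>
    (𝔄 s).subtype ∘ₗ DirectSum.component ℂ S (fun s => 𝔄 s) s ∘ₗ e.toLinearMap
  have hQ : ∀ s x, Q s x = (e x s : A) := fun s x => rfl
  have hmem : ∀ s x, Q s x ∈ 𝔄 s := fun s x => (e x s).2
  have hsum : ∀ x, ∑ s, Q s x = x := by
    intro x
    have h1 : DirectSum.coeLinearMap 𝔄 (e x) = x :=
      (LinearEquiv.ofBijective (DirectSum.coeLinearMap 𝔄) this).apply_symm_apply x
    conv_rhs => rw [← h1]
    rw [DirectSum.coeLinearMap_eq_dfinsuppSum, DFinsupp.sum_eq_sum_fintype _ (by simp)]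
    rfl
  have hnorm : ∀ x, ∑ s, ‖Q s x‖ = ‖x‖ := by
    intro x
    conv_rhs => rw [← hsum x]
    exact (h.norm_sum fun s => e x s).symm
  refine ⟨fun s => (Q s).mkContinuous 1 fun x => ?_, hmem, hsum, hnorm, fun s t a ha => ?_⟩
  · rw [one_mul, ← hnorm x]
    exact Finset.single_le_sum (f := fun s => ‖Q s x‖) (fun _ _ => norm_nonneg _)
      (Finset.mem_univ s)
  · have h1 : e a = DirectSum.lof ℂ S (fun s => 𝔄 s) t ⟨a, ha⟩ :=
      (LinearEquiv.symm_apply_eq _).2 (DirectSum.coeLinearMap_lof 𝔄 t ⟨a, ha⟩).symm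
    change Q s a = _
    rw [hQ, h1]
    split_ifs with hst
    · subst hst; simp [DirectSum.lof_apply]
    · rw [DirectSum.lof_eq_of, DirectSum.of_eq_of_ne _ _ _ hst]; rfl

end

end Amenability

/-! ### Units of the components and the central idempotents they generate. -/

namespace Amenability

open Projective

universe u

section

variable {A : Type u} [NonUnitalNormedRing A] [NormedSpace ℂ A] [IsScalarTower ℂ A A]
  [SMulCommClass ℂ A A] {n : ℕ}

/-- Units `e k` of the components of an algebra graded over a linear semilattice, each of them
acting as a unit on all the components below. -/
structure IsUnitSystem (𝔄 : Fin (n + 1) → Submodule ℂ A) (e : Fin (n + 1) → A) : Prop where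
  mem : ∀ k, e k ∈ 𝔄 k
  mul_eq : ∀ s t, t ≤ s → ∀ a ∈ 𝔄 t, e s * a = a
  eq_mul : ∀ s t, t ≤ s → ∀ a ∈ 𝔄 t, a * e s = a
  norm_eq : ∀ k, ‖e k‖ = 1

/-- The differences `e k - e (k - 1)`, with `e (-1) = 0`. -/
def gap (e : Fin (n + 1) → A) : Fin (n + 1) → A :=
  Fin.cases (e 0) fun i => e i.succ - e i.castSucc

@[simp]
theorem gap_zero (e : Fin (n + 1) → A) : gap e 0 = e 0 := rfl

@[simp]
theorem gap_succ (e : Fin (n + 1) → A) (i : Fin n) :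
    gap e i.succ = e i.succ - e i.castSucc := rfl

theorem sum_gap (e : Fin (n + 1) → A) : ∑ k, gap e k = e (Fin.last n) := by
  have h := (Fin.sum_univ_succ e).symm.trans (Fin.sum_univ_castSucc e)
  simp only [Fin.sum_univ_succ, gap_zero, gap_succ, Finset.sum_sub_distrib]
  rw [← add_sub_assoc, h]
  abel

theorem IsGraded.exists_isUnitSystem [CompleteSpace A] {𝔄 : Fin (n + 1) → Submodule ℂ A}
    (hgr : IsGraded 𝔄) (hLA1 : LA1 𝔄) (hcontr : ∀ k, IsContractible (hgr.component k))
    (hAM : ∀ k, amenabilityConstant (hgr.component k) = 1) : ∃ e, IsUnitSystem 𝔄 e := by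
  choose u hu using fun k => (hcontr k).exists_unit
  have hl : ∀ k, ∀ a ∈ 𝔄 k, (u k : A) * a = a := fun k a ha =>
    congrArg Subtype.val (hu k ⟨a, ha⟩).1
  have hr : ∀ k, ∀ a ∈ 𝔄 k, a * (u k : A) = a := fun k a ha =>
    congrArg Subtype.val (hu k ⟨a, ha⟩).2
  refine ⟨fun k => u k, fun k => (u k).2, fun s t hts a ha => ?_, fun s t hts a ha => ?_,
    fun k => norm_unit_eq_one (hAM k) (hu k)⟩
  all_goals
    obtain ⟨ι, _, _, _, v, hv, -, hlim⟩ := hLA1 s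
    obtain ⟨h1, h2⟩ := hlim t hts a ha
  -- Since u_s v_i = v_i, the nets u_s v_i a and v_i a coincide; their limits are u_s a and a.
  · refine tendsto_nhds_unique (h1.const_mul (u s : A)) ?_
    simpa only [← mul_assoc, hl s _ (hv _)] using h1
  · refine tendsto_nhds_unique (h2.mul_const (u s : A)) ?_
    simpa only [mul_assoc, hr s _ (hv _)] using h2

namespace IsUnitSystem

variable {𝔄 : Fin (n + 1) → Submodule ℂ A} {e : Fin (n + 1) → A}

section Algebraic

variable (h : IsUnitSystem 𝔄 e) (hgr : IsGraded 𝔄)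
include h hgr

/-- For z in `𝔄 t`, both e_k z and z e_k lie in the component of min(k, t), where e_k is a two-sided
unit. Hence both equal e_k z e_k. -/
theorem comm (k : Fin (n + 1)) (z : A) : e k * z = z * e k := by
  obtain ⟨P, hP, hsum, -, -⟩ := hgr.exists_proj
  rw [← hsum z, Finset.mul_sum, Finset.sum_mul]
  refine Finset.sum_congr rfl fun t _ => ?_
  have h1 := h.eq_mul k _ inf_le_left _ (hgr.mul_mem k t _ _ (h.mem k) (hP t z))
  have h2 := h.mul_eq k _ inf_le_right _ (hgr.mul_mem t k _ _ (hP t z) (h.mem k))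
  rw [← h1, mul_assoc, h2]

theorem gap_comm (k : Fin (n + 1)) (z : A) : gap e k * z = z * gap e k := by
  cases k using Fin.cases with
  | zero => exact h.comm hgr 0 z
  | succ i => rw [gap_succ, sub_mul, mul_sub, h.comm hgr, h.comm hgr]

theorem last_mul (z : A) : e (Fin.last n) * z = z := by
  obtain ⟨P, hP, hsum, -, -⟩ := hgr.exists_proj
  conv_rhs => rw [← hsum z]
  conv_lhs => rw [← hsum z, Finset.mul_sum]
  exact Finset.sum_congr rfl fun t _ => h.mul_eq _ _ (Fin.le_last t) _ (hP t z)

theorem mul_last (z : A) : z * e (Fin.last n) = z := by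
  rw [← h.comm hgr, h.last_mul hgr]

omit hgr in
theorem gap_mul_self (k : Fin (n + 1)) : gap e k * e k = gap e k := by
  cases k using Fin.cases with
  | zero => exact h.mul_eq 0 0 le_rfl _ (h.mem 0)
  | succ i =>
    rw [gap_succ, sub_mul, h.mul_eq _ _ le_rfl _ (h.mem _),
      h.eq_mul _ _ Fin.castSucc_lt_succ.le _ (h.mem _)]

omit hgr in
theorem gap_mul_gap (k : Fin (n + 1)) : gap e k * gap e k = gap e k := by
  cases k using Fin.cases with
  | zero => exact h.mul_eq 0 0 le_rfl _ (h.mem 0)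
  | succ i =>
    have hi := (Fin.castSucc_lt_succ (i := i)).le
    simp only [gap_succ, sub_mul, mul_sub, h.mul_eq _ _ le_rfl _ (h.mem _),
      h.eq_mul _ _ hi _ (h.mem _), h.mul_eq _ _ hi _ (h.mem _)]
    abel

/-- Components below k are killed by g_k, since e_k and e_{k-1} both act there as the identity. On
those from k upwards g_k = g_k e_k, and e_k pushes them into `𝔄 k`. -/
theorem exists_gap_mul_eq (k : Fin (n + 1)) (z : A) : ∃ w ∈ 𝔄 k, gap e k * z = gap e k * w := by
  obtain ⟨P, hP, hsum, -, -⟩ := hgr.exists_proj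
  have key : ∀ t, ∃ w ∈ 𝔄 k, gap e k * P t z = gap e k * w := by
    intro t
    rcases le_or_gt k t with hkt | hkt
    · refine ⟨e k * P t z, ?_, by rw [← mul_assoc, h.gap_mul_self]⟩
      have := hgr.mul_mem k t _ _ (h.mem k) (hP t z)
      rwa [inf_eq_left.2 hkt] at this
    · refine ⟨0, zero_mem _, ?_⟩
      cases k using Fin.cases with
      | zero => exact absurd hkt (Fin.not_lt_zero t)
      | succ i =>
        rw [gap_succ, sub_mul, h.mul_eq _ _ hkt.le _ (hP t z),
          h.mul_eq _ _ (Fin.le_castSucc_iff.2 hkt) _ (hP t z), sub_self, mul_zero]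
  choose w hw hzw using key
  refine ⟨∑ t, w t, sum_mem fun t _ => hw t, ?_⟩
  conv_lhs => rw [← hsum z]
  simp only [Finset.mul_sum, hzw]

end Algebraic

/-! ### The upper bound. -/

theorem sum_norm_gap_sq_le (h : IsUnitSystem 𝔄 e) : ∑ k, ‖gap e k‖ ^ 2 ≤ 4 * n + 1 := by
  have h1 : ∀ i : Fin n, ‖gap e i.succ‖ ^ 2 ≤ 4 := fun i => by
    have := norm_sub_le (e i.succ) (e i.castSucc)
    rw [h.norm_eq, h.norm_eq] at this
    rw [gap_succ]
    nlinarith [norm_nonneg (e i.succ - e i.castSucc)]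
  rw [Fin.sum_univ_succ, gap_zero, h.norm_eq]
  have := Finset.sum_le_sum fun i (_ : i ∈ Finset.univ) => h1 i
  simp only [Finset.sum_const, Finset.card_univ, Fintype.card_fin, nsmul_eq_mul] at this
  linarith

/-- The images under m tend to ∑ g_k e_k g_k = ∑ g_k, the unit of `A`. Asymptotic centrality for a
in `A` reduces, in the k-th summand, to that of D_k for an element w of `𝔄 k` with g_k a = g_k w. -/
theorem isBoundedApproxDiagonal_sum [CompleteSpace A] (h : IsUnitSystem 𝔄 e)
    (hgr : IsGraded 𝔄) {ι : Type u} [Preorder ι]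
    {D : ∀ k, ι → PTensor (hgr.component k) (hgr.component k)}
    (hD : ∀ k, IsBoundedApproxDiagonal (D k)) :
    IsBoundedApproxDiagonal fun i => ∑ k, leftAct (gap e k)
      (rightAct (gap e k) (tensorIncl (hgr.component k) (D k i))) := by
  have hm : Tendsto (fun i => mulMap A (∑ k, leftAct (gap e k)
      (rightAct (gap e k) (tensorIncl (hgr.component k) (D k i))))) atTop
      (𝓝 (e (Fin.last n))) := by
    rw [← sum_gap e]
    simp only [map_sum, mulMap_leftAct, mulMap_rightAct, mulMap_tensorIncl]
    refine tendsto_finsetSum _ fun k _ => ?_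
    have h1 := ((hD k).tendsto_mulMap_mul ⟨e k, h.mem k⟩)
    have h2 : Tendsto (fun i => (mulMap (hgr.component k) (D k i) : A) * e k) atTop (𝓝 (e k)) :=
      (continuous_subtype_val.tendsto _).comp h1
    have h3 := (h2.const_mul (gap e k)).mul_const (gap e k)
    rw [h.gap_mul_self, h.gap_mul_gap] at h3
    refine h3.congr fun i => ?_
    rw [h.eq_mul k k le_rfl _ (mulMap (hgr.component k) (D k i)).2, mul_assoc]
  refine ⟨?_, fun a => ?_, fun a => ?_, fun a => ?_⟩
  · choose C hC using fun k => (hD k).bounded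
    refine ⟨∑ k, ‖gap e k‖ * (‖gap e k‖ * C k), fun i => norm_sum_le_of_le _ fun k _ => ?_⟩
    refine (norm_leftAct_le _ _).trans ?_
    gcongr
    refine (norm_rightAct_le _ _).trans ?_
    gcongr
    exact (norm_tensorIncl_le _ _).trans (hC k i)
  · simpa only [h.mul_last hgr] using hm.const_mul a
  · simpa only [h.last_mul hgr] using hm.mul_const a
  · simp only [map_sum, ← Finset.sum_sub_distrib]
    rw [show (0 : PTensor A A) = ∑ k : Fin (n + 1), 0 by simp]
    refine tendsto_finsetSum _ fun k _ => ?_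
    obtain ⟨w, hw, haw⟩ := h.exists_gap_mul_eq hgr k a
    have h1 := (hD k).tendsto_central ⟨w, hw⟩
    let T := (leftAct (gap e k)).comp ((rightAct (gap e k)).comp (tensorIncl (hgr.component k)))
    have h2 := (T.continuous.tendsto 0).comp h1
    rw [map_zero] at h2
    refine h2.congr fun i => ?_
    simp only [T, Function.comp_apply, ContinuousLinearMap.comp_apply, map_sub,
      tensorIncl_leftAct, tensorIncl_rightAct]
    simp only [leftAct_rightAct, leftAct_leftAct, rightAct_rightAct]
    rw [← h.gap_comm hgr k a, haw, h.gap_comm hgr k w]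

theorem amenabilityConstant_le [CompleteSpace A] (h : IsUnitSystem 𝔄 e) (hgr : IsGraded 𝔄)
    (hAM : ∀ k, amenabilityConstant (hgr.component k) ≤ 1) {c : ℝ} (hc : 1 < c) :
    amenabilityConstant A ≤ ENNReal.ofReal ((4 * n + 1) * c) := by
  choose ι _ _ _ D hD hb using fun k => exists_isBoundedApproxDiagonal_of_lt
    (A := hgr.component k) (c := c) ((hAM k).trans_lt (by simpa using hc))
  -- The nets for different k have different index sets, so all are reindexed by the product of
  -- these sets.
  have : IsDirectedOrder (∀ k, ι k) := ⟨fun a b => by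
    choose d hd using fun k => exists_ge_ge (a k) (b k)
    exact ⟨d, fun k => (hd k).1, fun k => (hd k).2⟩⟩
  have hproj : ∀ k, Tendsto (fun i : ∀ k, ι k => i k) atTop atTop := fun k =>
    tendsto_atTop_atTop.2 fun b =>
      ⟨Function.update (fun k => Classical.arbitrary (ι k)) k b, fun a ha => by
        simpa using ha k⟩
  have hD' : ∀ k, IsBoundedApproxDiagonal fun i : ∀ k, ι k => D k (i k) := fun k =>
    ⟨⟨c, fun i => hb k (i k)⟩, fun a => ((hD k).tendsto_mul_mulMap a).comp (hproj k),
      fun a => ((hD k).tendsto_mulMap_mul a).comp (hproj k),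
      fun a => ((hD k).tendsto_central a).comp (hproj k)⟩
  refine Amenability.amenabilityConstant_le (h.isBoundedApproxDiagonal_sum hgr hD') fun i => ?_
  have h1 : ∀ k, ‖leftAct (gap e k) (rightAct (gap e k)
      (tensorIncl (hgr.component k) (D k (i k))))‖ ≤ ‖gap e k‖ ^ 2 * c := fun k => by
    rw [sq, mul_assoc]
    refine (norm_leftAct_le _ _).trans ?_
    gcongr
    refine (norm_rightAct_le _ _).trans ?_
    gcongr
    exact (norm_tensorIncl_le _ _).trans (hb k (i k))
  refine (norm_sum_le_of_le _ fun k _ => h1 k).trans ?_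
  rw [← Finset.sum_mul]
  exact mul_le_mul_of_nonneg_right h.sum_norm_gap_sq_le (by linarith)

/-! ### The lower bound. -/

/-- A bounded bilinear form of norm at most one that detects the amenability constant. -/
theorem exists_bilinear_form (h : IsUnitSystem 𝔄 e) (hgr : IsGraded 𝔄) :
    ∃ F : A →L[ℂ] A →L[ℂ] ℂ, (∀ x y, ‖F x y‖ ≤ 1 * ‖x‖ * ‖y‖) ∧
      (∀ k x y, F (gap e k * x) (y * gap e k) = F (gap e k * (x * y)) (gap e k)) ∧
      ∑ k, F (gap e k) (gap e k) = 4 * n + 1 := by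
  obtain ⟨P, hP, hsum, hnorm, hPa⟩ := hgr.exists_proj
  have hne : ∀ k, e k ≠ 0 := fun k h0 => by simpa [h0] using h.norm_eq k
  -- Hahn–Banach: ‖f_k‖ = 1 and f_k(e_k) = ‖e_k‖ = 1.
  choose f hf1 hfe using fun k => exists_dual_vector ℂ (e k) (norm_ne_zero_iff.2 (hne k))
  simp only [h.norm_eq, RCLike.ofReal_one] at hfe
  let F : A →L[ℂ] A →L[ℂ] ℂ := ∑ s : Fin (n + 1), ∑ t : Fin (n + 1),
    ((-1 : ℂ) ^ ((s : ℕ) + t)) • ((ContinuousLinearMap.compL ℂ A A ℂ (f (s ⊓ t))).comp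
      (ContinuousLinearMap.mul ℂ A)).bilinearComp (P s) (P t)
  have hF : ∀ x y, F x y = ∑ s : Fin (n + 1), ∑ t : Fin (n + 1),
      (-1 : ℂ) ^ ((s : ℕ) + t) * f (s ⊓ t) (P s x * P t y) := fun x y => by
    simp [F]
  have hFh : ∀ s t, ∀ a ∈ 𝔄 s, ∀ b ∈ 𝔄 t,
      F a b = (-1 : ℂ) ^ ((s : ℕ) + t) * f (s ⊓ t) (a * b) := fun s t a ha b hb => by
    rw [hF, Finset.sum_eq_single s, Finset.sum_eq_single t]
    · rw [hPa s s a ha, hPa t t b hb, if_pos rfl, if_pos rfl]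
    · intro t' _ ht'; rw [hPa t' t b hb, if_neg ht']; simp
    · simp
    · intro s' _ hs'
      refine Finset.sum_eq_zero fun t' _ => ?_
      rw [hPa s' s a ha, if_neg hs']; simp
    · simp
  have hsub : ∀ k, ∀ a ∈ 𝔄 k, ∀ b ∈ 𝔄 k, ∀ i, e i * a * (e i * b) = e i * (a * b) :=
    fun k a _ b _ i => by
      rw [mul_assoc, ← mul_assoc a, ← h.comm hgr i a, mul_assoc, ← mul_assoc,
        h.mul_eq i i le_rfl _ (h.mem i)]
  have hzero : ∀ a ∈ 𝔄 0, ∀ b ∈ 𝔄 0, F (gap e 0 * a) (gap e 0 * b) = f 0 (a * b) :=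
    fun a ha b hb => by
      rw [gap_zero, h.mul_eq 0 0 le_rfl a ha, h.mul_eq 0 0 le_rfl b hb, hFh 0 0 a ha b hb]
      simp
  -- Expanding both differences gives four terms. The two mixed ones carry a minus sign that cancels
  -- against (-1)^{s+t} = -1, so together with the (k-1, k-1) term there are three equal
  -- contributions of f_{k-1}.
  have hsucc : ∀ i : Fin n, ∀ a ∈ 𝔄 i.succ, ∀ b ∈ 𝔄 i.succ,
      F (gap e i.succ * a) (gap e i.succ * b)
        = f i.succ (a * b) + 3 * f i.castSucc (e i.castSucc * (a * b)) := by
    intro i a ha b hb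
    have hle := (Fin.castSucc_lt_succ (i := i)).le
    have hmem : ∀ x ∈ 𝔄 i.succ, e i.castSucc * x ∈ 𝔄 i.castSucc := fun x hx => by
      have := hgr.mul_mem _ _ _ _ (h.mem i.castSucc) hx
      rwa [inf_eq_left.2 hle] at this
    simp only [gap_succ, sub_mul, h.mul_eq _ _ le_rfl a ha, h.mul_eq _ _ le_rfl b hb]
    have h1 : a * (e i.castSucc * b) = e i.castSucc * (a * b) := by
      rw [← mul_assoc, ← h.comm hgr, mul_assoc]
    simp only [map_sub, sub_apply]
    rw [hFh _ _ a ha b hb, hFh _ _ a ha _ (hmem b hb), hFh _ _ _ (hmem a ha) b hb,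
      hFh _ _ _ (hmem a ha) _ (hmem b hb), hsub _ a ha b hb, h1, mul_assoc, inf_idem, inf_idem,
      inf_eq_right.2 hle, inf_eq_left.2 hle, ← two_mul, ← two_mul]
    have h2 : (-1 : ℂ) ^ ((i.succ : ℕ) + (i.castSucc : ℕ)) = -1 :=
      Odd.neg_one_pow ⟨i, by simp; ring⟩
    have h3 : (-1 : ℂ) ^ ((i.castSucc : ℕ) + (i.succ : ℕ)) = -1 :=
      Odd.neg_one_pow ⟨i, by simp; ring⟩
    rw [h2, h3, pow_mul, pow_mul]
    ring
  refine ⟨F, fun x y => ?_, fun k x y => ?_, ?_⟩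
  -- The ℓ¹-norm makes ‖x‖ ‖y‖ equal to the double sum of ‖x_s‖ ‖y_t‖, which dominates F termwise.
  · rw [hF, one_mul, ← hnorm x, ← hnorm y, Finset.sum_mul_sum]
    refine norm_sum_le_of_le _ fun s _ => norm_sum_le_of_le _ fun t _ => ?_
    rw [norm_mul, norm_pow, norm_neg, norm_one, one_pow, one_mul]
    refine ((f (s ⊓ t)).le_opNorm _).trans ?_
    rw [hf1, one_mul]
    exact norm_mul_le _ _
  · obtain ⟨a, ha, hxa⟩ := h.exists_gap_mul_eq hgr k x
    obtain ⟨b, hb, hyb⟩ := h.exists_gap_mul_eq hgr k y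
    have hab : a * b ∈ 𝔄 k := by simpa using hgr.mul_mem k k a b ha hb
    have h1 : gap e k * (x * y) = gap e k * (a * b) := by
      rw [← mul_assoc, hxa, h.gap_comm hgr k a, mul_assoc, hyb, ← mul_assoc,
        ← h.gap_comm hgr k a, mul_assoc]
    rw [h1, ← h.gap_comm hgr k y, hxa, hyb]
    -- Writing g_k = g_k e_k turns the right side into the value at the pair (ab, e_k), whose
    -- product is again ab.
    conv_rhs => rw [← h.gap_mul_self k, mul_assoc, h.mul_eq k k le_rfl _ hab]
    cases k using Fin.cases with
    | zero =>
      rw [hzero a ha b hb, hzero _ hab _ (h.mem 0), h.eq_mul _ _ le_rfl _ hab]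
    | succ i =>
      rw [hsucc i a ha b hb, hsucc i _ hab _ (h.mem _), h.eq_mul _ _ le_rfl _ hab]
  · have h0 : F (gap e 0) (gap e 0) = 1 := by
      have := hzero _ (h.mem 0) _ (h.mem 0)
      rwa [h.gap_mul_self, h.mul_eq 0 0 le_rfl _ (h.mem 0), hfe] at this
    have h1 : ∀ i : Fin n, F (gap e i.succ) (gap e i.succ) = 4 := fun i => by
      have := hsucc i _ (h.mem _) _ (h.mem _)
      rw [h.gap_mul_self, h.mul_eq _ _ le_rfl _ (h.mem _),
        h.eq_mul _ _ Fin.castSucc_lt_succ.le _ (h.mem _), hfe, hfe] at this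
      rw [this]; norm_num
    rw [Fin.sum_univ_succ, h0, Finset.sum_congr rfl fun i _ => h1 i]
    simp
    ring

/-- As the g_k are idempotents with sum the unit, D = ∑ g_k · (g_k · D), and asymptotic centrality
replaces the inner g_k · D by D · g_k. On g_k · D · g_k the form sees only m(D), which acts in the
limit as a unit. -/
theorem le_amenabilityConstant [CompleteSpace A] (h : IsUnitSystem 𝔄 e) (hgr : IsGraded 𝔄) :
    4 * (n : ℝ≥0∞) + 1 ≤ amenabilityConstant A := by
  obtain ⟨F, hF1, hFm, hFe⟩ := h.exists_bilinear_form hgr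
  refine le_sInf ?_
  rintro _ ⟨ι, _, _, _, D, hD, rfl⟩
  have hL : ∀ k X, lift F (leftAct (gap e k) (rightAct (gap e k) X))
      = F (gap e k * mulMap A X) (gap e k) := fun k X => by
    have : (lift F).comp ((leftAct (gap e k)).comp (rightAct (gap e k)))
        = (F.flip (gap e k)).comp
          ((ContinuousLinearMap.mul ℂ A (gap e k)).comp (mulMap A)) :=
      ext_tmul fun x y => by simp [hFm]
    exact congr($this X)
  have h1 : Tendsto (fun i => ∑ k, lift F (leftAct (gap e k) (rightAct (gap e k) (D i)))) atTop
      (𝓝 (4 * n + 1)) := by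
    rw [← hFe]
    refine tendsto_finsetSum _ fun k _ => ?_
    simp only [hL]
    exact ((F.flip (gap e k)).continuous.tendsto _).comp (hD.tendsto_mul_mulMap (gap e k))
  have h2 : Tendsto (fun i => ∑ k, lift F (leftAct (gap e k)
      (leftAct (gap e k) (D i) - rightAct (gap e k) (D i)))) atTop (𝓝 0) := by
    rw [show (0 : ℂ) = ∑ k : Fin (n + 1), 0 by simp]
    refine tendsto_finsetSum _ fun k _ => ?_
    have := (((lift F).comp (leftAct (gap e k))).continuous.tendsto 0).comp
      (hD.tendsto_central (gap e k))
    rwa [map_zero] at this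
  have h3 : Tendsto (fun i => lift F (D i)) atTop (𝓝 (4 * n + 1)) := by
    refine (add_zero (4 * (n : ℂ) + 1) ▸ h1.add h2).congr fun i => ?_
    rw [← Finset.sum_add_distrib]
    conv_rhs => rw [← leftAct_of_forall_mul_eq (h.last_mul hgr) (D i), ← sum_gap e, leftAct_sum,
      map_sum]
    refine Finset.sum_congr rfl fun k _ => ?_
    rw [map_sub, map_sub, add_sub_cancel, leftAct_leftAct, h.gap_mul_gap]
  have h4 : 4 * (n : ℝ≥0∞) + 1 = ‖(4 * n + 1 : ℂ)‖ₑ := by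
    rw [← ofReal_norm, show (4 * n + 1 : ℂ) = ((4 * n + 1 : ℕ) : ℂ) by push_cast; ring,
      Complex.norm_natCast, ENNReal.ofReal_natCast]
    push_cast; ring
  rw [h4]
  refine le_of_tendsto h3.enorm (Eventually.of_forall fun i => ?_)
  refine le_trans ?_ (le_iSup (fun i => ‖D i‖ₑ) i)
  have := norm_lift_apply_le_of_bound zero_le_one hF1 (D i)
  rw [one_mul] at this
  rw [← ofReal_norm, ← ofReal_norm]
  exact ENNReal.ofReal_le_ofReal this

end IsUnitSystem

end

end Amenability

theorem proposition2p3 (n : ℕ) {A : Type*} [NonUnitalNormedRing A] [NormedSpace ℂ A]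
    [IsScalarTower ℂ A A] [SMulCommClass ℂ A A] [CompleteSpace A]
    (𝔄 : Fin (n + 1) → Submodule ℂ A)
    (hgr : Amenability.IsGraded 𝔄)
    (hLA1 : Amenability.LA1 𝔄)
    (hcontr : ∀ k, Amenability.IsContractible (hgr.component k))
    (hAM : ∀ k, Amenability.amenabilityConstant (hgr.component k) = 1) :
    Amenability.amenabilityConstant A = 4 * (n : ℝ≥0∞) + 1 := by
  obtain ⟨e, he⟩ := hgr.exists_isUnitSystem hLA1 hcontr hAM
  refine le_antisymm ?_ (he.le_amenabilityConstant hgr)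
  have hpos : (0 : ℝ) < 4 * n + 1 := by positivity
  have h1 : 4 * (n : ℝ≥0∞) + 1 = ENNReal.ofReal (4 * n + 1) := by
    rw [show (4 * n + 1 : ℝ) = ((4 * n + 1 : ℕ) : ℝ) by push_cast; ring, ENNReal.ofReal_natCast]
    push_cast; ring
  have h2 : Tendsto (fun c : ℝ => ENNReal.ofReal ((4 * n + 1) * c)) (𝓝[>] 1)
      (𝓝 (ENNReal.ofReal ((4 * n + 1) * 1))) :=
    (ENNReal.continuous_ofReal.comp (continuous_const.mul continuous_id)).continuousWithinAt
  rw [h1, ← mul_one (4 * n + 1 : ℝ)]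
  -- The infimum defining AM of a component need not be attained, so the bound is available only for
  -- c > 1 and c ↓ 1 is taken at the end.
  exact ge_of_tendsto h2 (eventually_nhdsWithin_of_forall fun c hc =>
    he.amenabilityConstant_le hgr (fun k => (hAM k).le) hc)
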